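/- \textbf{Theorem (A better choice of $a$).} There is a universal constant $C>0$ with the following property. Let $d\ge 1$, let $\Sigma_*\in\mathbb R^{d\times d}$ be symmetric positive definite, and write $\Sigma_*^{-1}=P\,\mathrm{diag}(s_1,\dots,s_d)\,P^{T}$ with $P$ orthogonal and $s_1\ge\dots\ge s_d>0$; assume $s_1>1>s_d$ and put $\kappa=s_1/s_d$. Let $f(x)=\tfrac12 x^T\Sigma_*^{-1}x$ and $$a=\frac{2}{\sqrt{s_1}-\sqrt{s_d}},\qquad \gamma=as_d+2\sqrt{s_d},\qquad h=\frac1{2(as_1+\gamma)} .$$ Consider the Euler--Maruyama discretization with step size $h$ of gradient-adjusted underdamped Langevin dynamics (GAUL) with preconditioner $C=I$, $$x_{k+1}=x_k-ah\nabla f(x_k)+hp_k+\sqrt{2ah}\,z^{(1)}_k,\qquad p_{k+1}=p_k-h\nabla f(x_k)-\gamma h\,p_k+\sqrt{2\gamma h}\,z^{(2)}_k,$$ where $z_k^{(1)},z_k^{(2)}\sim\mathcal N(0,I_d)$ are independent of each other, of the past and of the initial state $(x_0,p_0)\sim\mathcal N(0,I_{2d})$. Let $\nu_k$ be the law of $x_k$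 (so $\nu_0=\mathcal N(0,I_d)$), and let $\tilde\pi=\mathcal N\big(0,P\,\mathrm{diag}(y_1,\dots,y_d)P^T\big)$ be the biased target, where $$y_i=\frac1{s_i}\left(1-\frac{hs_i\big(4+(h+a(h\gamma-2))(hs_i-\gamma+as_i(h\gamma-1))\big)}{(hs_i-\gamma+as_i(h\gamma-1))\big(4+h(hs_i-2\gamma+as_i(h\gamma-2))\big)}\right).$$ Let $\mathrm{TV}(\mu,\nu)=\sup_A|\mu(A)-\nu(A)|$ (supremum over measurable sets) and $t^{\mathrm{dis}}_{\mathrm{mix}}(\delta;\nu_0,\tilde\pi)=\min\{k\ge 0:\mathrm{TV}(\nu_k,\tilde\pi)\le\delta\}$. Then $\tilde\pi$ is the $x$-marginal of a stationary law of the chain $(x_k,p_k)$, $\mathrm{TV}(\nu_k,\tilde\pi)\to0$ as $k\to\infty$, and for every $\delta\in(0,1)$ $$t^{\mathrm{dis}}_{\mathrm{mix}}(\delta;\nu_0,\tilde\pi)\le C\,\sqrt{\kappa}\,\big(\log\kappa+\log(1/\delta)+\log d\big).$$ -/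

import Mathlib

open MeasureTheory ProbabilityTheory Filter Topology

noncomputable section

/-- Total variation distance `sup_A |μ(A) - ν(A)|` over measurable sets `A`
(used for probability measures). -/
def tvDistance {Ω : Type*} [MeasurableSpace Ω] (μ ν : Measure Ω) : ℝ :=
  ⨆ A : {A : Set Ω // MeasurableSet A}, |μ.real A.1 - ν.real A.1|

/-- Discrete `δ`-mixing time of a sequence of laws `law k` towards `ν`: the least `k` with
`TV (law k, ν) ≤ δ`. (Meaningful when such a `k` exists, e.g. when `law k` converges to `ν`.) -/
def discreteMixingTime {Ω : Type*} [MeasurableSpace Ω] (law : ℕ → Measure Ω) (ν : Measure Ω)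
    (δ : ℝ) : ℕ :=
  sInf {k : ℕ | tvDistance (law k) ν ≤ δ}

/-- The quadratic potential `f x = (1/2) xᵀ Σ⁻¹ x`. -/
def quadPotential {d : ℕ} (S : Matrix (Fin d) (Fin d) ℝ) (x : EuclideanSpace ℝ (Fin d)) : ℝ :=
  (1 / 2) * (x.ofLp ⬝ᵥ (S⁻¹).mulVec x.ofLp)

/-- One Euler-Maruyama step, with step size `h`, of gradient-adjusted underdamped Langevin dynamics
(with `C = I`) `dx = (-a ∇f(x) + p) dt + √(2a) dB¹`, `dp = (-∇f(x) - γ p) dt + √(2γ) dB²`,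
from the state `(x, p)`, with noise `(z₁, z₂)`. -/
def gaulStep {d : ℕ} (f : EuclideanSpace ℝ (Fin d) → ℝ) (a γ h : ℝ)
    (X Z : EuclideanSpace ℝ (Fin d) × EuclideanSpace ℝ (Fin d)) :
    EuclideanSpace ℝ (Fin d) × EuclideanSpace ℝ (Fin d) :=
  (X.1 - (a * h) • gradient f X.1 + h • X.2 + Real.sqrt (2 * a * h) • Z.1,
    X.2 - h • gradient f X.1 - (γ * h) • X.2 + Real.sqrt (2 * γ * h) • Z.2)

/-- The law `N(0, I)` on `ℝᵈ × ℝᵈ`. -/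
def stdGaussianPair (d : ℕ) :
    Measure (EuclideanSpace ℝ (Fin d) × EuclideanSpace ℝ (Fin d)) :=
  (stdGaussian (EuclideanSpace ℝ (Fin d))).prod (stdGaussian (EuclideanSpace ℝ (Fin d)))

/-- The operator on laws of the Euler-Maruyama scheme: the law of the next state when the current
state has law `μ` and the noise is a standard Gaussian independent of it. -/
def gaulOperator {d : ℕ} (f : EuclideanSpace ℝ (Fin d) → ℝ) (a γ h : ℝ)
    (μ : Measure (EuclideanSpace ℝ (Fin d) × EuclideanSpace ℝ (Fin d))) :
    Measure (EuclideanSpace ℝ (Fin d) × EuclideanSpace ℝ (Fin d)) :=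
  (μ.prod (stdGaussianPair d)).map (fun q => gaulStep f a γ h q.1 q.2)

/-- The law of `x_k`, the position after `k` Euler-Maruyama steps started from
`(x₀, p₀) ∼ N(0, I)`. -/
def gaulPositionLaw {d : ℕ} (f : EuclideanSpace ℝ (Fin d) → ℝ) (a γ h : ℝ) (k : ℕ) :
    Measure (EuclideanSpace ℝ (Fin d)) :=
  ((gaulOperator f a γ h)^[k] (stdGaussianPair d)).map Prod.fst

/-- The limiting variance of the position along an eigendirection of `Σ⁻¹` with eigenvalue `s`. -/
def biasedVariance (a γ h s : ℝ) : ℝ :=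
  (1 / s) * (1 - h * s * (4 + (h + a * (h * γ - 2)) * (h * s - γ + a * s * (h * γ - 1))) /
    ((h * s - γ + a * s * (h * γ - 1)) * (4 + h * (h * s - 2 * γ + a * s * (h * γ - 2)))))

/-- The biased Gaussian target, where `Σ⁻¹ = P diag(s) Pᵀ`. -/
def biasedTarget {d : ℕ} (P : Matrix (Fin d) (Fin d) ℝ) (s : Fin d → ℝ) (a γ h : ℝ) :
    Measure (EuclideanSpace ℝ (Fin d)) :=
  multivariateGaussian 0
    (P * Matrix.diagonal (fun i => biasedVariance a γ h (s i)) * P.transpose)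

end

/-!
The potential is quadratic, so the law of the chain stays centered Gaussian, and in the
eigenbasis of `Σ⁻¹` it splits into independent two-dimensional modes `(x, p)`, one for each
eigenvalue `s`. On a mode one step acts on covariances by `V ↦ A V Aᵀ + D` (`covStep`), with
`A = ((1 - ahs, h), (-hs, 1 - γh))` and `D = diag(2ah, 2γh)`. This is read off from characteristic
functions (`HasModeCov.gaulOperator`), where only the transpose of `A` (`modeDual`) intervenes. The
recursion has an explicit fixed point (`StableMode.covStep_stationaryCov`), whose position entry is
`biasedVariance`; the Gaussian law with these covariances is stationary.

The choice of `a` and `γ` makes `A` have nonreal or double eigenvalues for every `s` between `sd`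
and `s₁` (`stableMode_of_parameters`): the discriminant is a negative multiple of
`(s₁ - s) (s - sd)`. Both eigenvalues then have modulus `√(det A)`, and the choice of `h` gives
`det A ≤ 1 - 3 / (8 √κ)`. The powers of `A` are therefore at most of order `k (det A) ^ (k / 2)`,
uniformly up to the case of a double eigenvalue (`abs_le_of_linear_recurrence`), so that the
position variances converge with relative error at most `12 κ (1 + 4 k)² (det A) ^ k`. Constants are
polynomial in `κ` because `sd < 1 < s₁`.

For the total variation distance between Gaussians with the same eigenbasis and variances `v i`,
`w i`, both laws are compared with the Gaussian of variances `min (v i) (w i)`, a large multiple of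
which is dominated by each of them; this yields the bound `∑ i, |v i - w i| / w i`
(`tvDistance_map_pi_gaussianReal_le`). Altogether the distance after `k` steps is at most
`49152 d κ² exp (-k / (8 √κ))`, which gives the mixing time. Additive constants are absorbed by
`log d`, as `s₁ ≠ sd` forces `d ≥ 2`.
-/

noncomputable section

/-! ### Second-order linear recurrences with complex characteristic roots -/

/-- If both roots of `X² - tX + q` have modulus `√q`, the solutions of the recurrence grow at most
like `k √q ^ k`, uniformly up to the case of a double root: for a root `μ`, the differences
`x (k + 1) - μ x k` form a geometric progression. The factor `2` bounds `1 / √q`. -/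
theorem abs_le_of_linear_recurrence {t q : ℝ} {x : ℕ → ℝ} (hq : 1 / 4 ≤ q) (htq : t ^ 2 ≤ 4 * q)
    (hx : ∀ k, x (k + 2) = t * x (k + 1) - q * x k) (k : ℕ) :
    |x k| ≤ Real.sqrt q ^ k * (|x 0| + 2 * k * (|x 1| + Real.sqrt q * |x 0|)) := by
  set r := Real.sqrt q with hr
  have hr2 : r ^ 2 = q := Real.sq_sqrt (by linarith)
  have hr0 : 1 / 2 ≤ r := by
    rw [hr]; apply Real.le_sqrt_of_sq_le; norm_num; linarith
  set ω := Real.sqrt (q - t ^ 2 / 4) with hω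
  have hω2 : ω ^ 2 = q - t ^ 2 / 4 := Real.sq_sqrt (by linarith)
  set μ : ℂ := ⟨t / 2, ω⟩ with hμ
  set μ' : ℂ := ⟨t / 2, -ω⟩ with hμ'
  have hsum : μ + μ' = (t : ℂ) := by
    apply Complex.ext <;> simp [hμ, hμ']
  have hprod : μ * μ' = (q : ℂ) := by
    apply Complex.ext
    · simp [hμ, hμ']; nlinarith
    · simp [hμ, hμ']; ring
  have hnorm : ∀ z : ℂ, z.re = t / 2 → z.im ^ 2 = ω ^ 2 → ‖z‖ = r := by
    intro z h1 h2
    rw [Complex.norm_def, Complex.normSq_apply, hr, ← pow_two, ← pow_two, h1, h2, hω2]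
    congr 1
    ring
  have hnμ : ‖μ‖ = r := hnorm μ rfl rfl
  have hnμ' : ‖μ'‖ = r := hnorm μ' rfl (by simp [hμ'])
  have hgeo : ∀ k, (x (k + 1) : ℂ) - μ * x k = μ' ^ k * ((x 1 : ℂ) - μ * x 0) := by
    intro k
    induction k with
    | zero => simp
    | succ k ih =>
      have h1 : (x (k + 2) : ℂ) = (μ + μ') * x (k + 1) - μ * μ' * x k := by
        rw [hsum, hprod, hx k]; push_cast; ring
      calc (x (k + 1 + 1) : ℂ) - μ * x (k + 1) = μ' * ((x (k + 1) : ℂ) - μ * x k) := by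
            rw [show k + 1 + 1 = k + 2 from rfl, h1]; ring
        _ = _ := by rw [ih]; ring
  set c := |x 1| + r * |x 0| with hc
  have hc0 : 0 ≤ c := by positivity
  have hdiff : ‖(x 1 : ℂ) - μ * x 0‖ ≤ c := by
    refine (norm_sub_le _ _).trans ?_
    rw [norm_mul, hnμ]
    simp [hc]
  have hstep : ∀ k, |x (k + 1)| ≤ r * |x k| + r ^ k * c := by
    intro k
    have h1 : (x (k + 1) : ℂ) = μ * x k + μ' ^ k * ((x 1 : ℂ) - μ * x 0) := by
      rw [← hgeo k]; ring
    have h2 : |x (k + 1)| = ‖(x (k + 1) : ℂ)‖ := by simp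
    rw [h2, h1]
    refine (norm_add_le _ _).trans ?_
    rw [norm_mul, norm_mul, norm_pow, hnμ, hnμ']
    simp only [Complex.norm_real, Real.norm_eq_abs]
    gcongr
  induction k with
  | zero => simp
  | succ k ih =>
    calc |x (k + 1)| ≤ r * |x k| + r ^ k * c := hstep k
      _ ≤ r * (r ^ k * (|x 0| + 2 * k * c)) + r ^ k * (2 * r * c) := by
          gcongr
          nlinarith
      _ = r ^ (k + 1) * (|x 0| + 2 * ((k + 1 : ℕ) : ℝ) * c) := by push_cast; ring

/-! ### A single eigendirection -/

/-- Stability of the scheme along an eigendirection of curvature `s`: the drift matrix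
`((as, -1), (s, γ))` has trace `as + γ` and determinant `s (1 + aγ)`; its eigenvalues are not real
and distinct, and the step size is small compared with them. -/
structure StableMode (a γ h s : ℝ) : Prop where
  a_pos : 0 < a
  γ_pos : 0 < γ
  h_pos : 0 < h
  s_pos : 0 < s
  h_le_one : h ≤ 1
  h_le : h ≤ a
  h_trace_le : h * (a * s + γ) ≤ 1 / 2
  discr_nonpos : (a * s + γ) ^ 2 ≤ 4 * (s * (1 + a * γ))
  h_det_le : 4 * (h * (s * (1 + a * γ))) ≤ a * s + γ

/-- The transpose of the update matrix `((1 - ahs, h), (-hs, 1 - γh))` of a single mode, acting on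
dual variables. -/
def modeDual (a γ h s : ℝ) (z : ℝ × ℝ) : ℝ × ℝ :=
  ((1 - a * h * s) * z.1 - h * s * z.2, h * z.1 + (1 - γ * h) * z.2)

/-- The determinant of the update matrix of a single mode, the square of its spectral radius. -/
def modeDet (a γ h s : ℝ) : ℝ := 1 - h * (a * s + γ) + h ^ 2 * (s * (1 + a * γ))

/-- The quadratic form of a covariance matrix `((v.1, v.2.1), (v.2.1, v.2.2))`. -/
def covForm (v : ℝ × ℝ × ℝ) (z : ℝ × ℝ) : ℝ :=
  v.1 * z.1 ^ 2 + 2 * v.2.1 * (z.1 * z.2) + v.2.2 * z.2 ^ 2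

/-- The variance injected by the noise in one step. -/
def noiseForm (a γ h : ℝ) (z : ℝ × ℝ) : ℝ := 2 * a * h * z.1 ^ 2 + 2 * γ * h * z.2 ^ 2

/-- The covariance recursion `Σ ↦ A Σ Aᵀ + D` of a single mode. -/
def covStep (a γ h s : ℝ) (v : ℝ × ℝ × ℝ) : ℝ × ℝ × ℝ :=
  ((1 - a * h * s) ^ 2 * v.1 + 2 * (1 - a * h * s) * h * v.2.1 + h ^ 2 * v.2.2 + 2 * a * h,
    -(1 - a * h * s) * (h * s) * v.1 + ((1 - a * h * s) * (1 - γ * h) - h * s * h) * v.2.1 +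
      h * (1 - γ * h) * v.2.2,
    (h * s) ^ 2 * v.1 - 2 * (h * s) * (1 - γ * h) * v.2.1 + (1 - γ * h) ^ 2 * v.2.2 + 2 * γ * h)

theorem covForm_covStep (a γ h s : ℝ) (v : ℝ × ℝ × ℝ) (z : ℝ × ℝ) :
    covForm (covStep a γ h s v) z = covForm v (modeDual a γ h s z) + noiseForm a γ h z := by
  simp only [covForm, covStep, modeDual, noiseForm]
  ring

/-- The stationary covariance of a single mode. -/
def stationaryCov (a γ h s : ℝ) : ℝ × ℝ × ℝ :=
  (biasedVariance a γ h s,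
    2 * h * (a * s - γ) / ((a * s + γ - h * (s * (1 + a * γ))) *
      (4 - 2 * h * (a * s + γ) + h ^ 2 * (s * (1 + a * γ)))),
    1 + h * (4 * s + 2 * (a * s + γ - h * (s * (1 + a * γ))) * (γ - h * (s * (1 + a * γ)) / 2)) /
      ((a * s + γ - h * (s * (1 + a * γ))) *
      (4 - 2 * h * (a * s + γ) + h ^ 2 * (s * (1 + a * γ)))))

theorem biasedVariance_eq {a γ h s : ℝ} (hs : s ≠ 0) :
    biasedVariance a γ h s = 1 / s + h * (4 + (a * s + γ - h * (s * (1 + a * γ))) *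
      (2 * a - h * (1 + a * γ))) / ((a * s + γ - h * (s * (1 + a * γ))) *
      (4 - 2 * h * (a * s + γ) + h ^ 2 * (s * (1 + a * γ)))) := by
  unfold biasedVariance
  have e1 : h * s - γ + a * s * (h * γ - 1) = -(a * s + γ - h * (s * (1 + a * γ))) := by ring
  have e2 : 4 + h * (h * s - 2 * γ + a * s * (h * γ - 2)) =
      4 - 2 * h * (a * s + γ) + h ^ 2 * (s * (1 + a * γ)) := by ring
  rw [e1, e2, neg_mul, div_neg, sub_neg_eq_add, mul_add, mul_one, ← mul_div_assoc]
  congr 2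
  field_simp
  ring

namespace StableMode

variable {a γ h s : ℝ}

theorem det_pos (H : StableMode a γ h s) : 0 < s * (1 + a * γ) := by
  have := H.s_pos; have := H.a_pos; have := H.γ_pos; positivity

theorem trace_pos (H : StableMode a γ h s) : 0 < a * s + γ := by
  have := H.s_pos; have := H.a_pos; have := H.γ_pos; positivity

theorem one_fourth_le_modeDet (H : StableMode a γ h s) : 1 / 4 ≤ modeDet a γ h s := by
  have := H.h_trace_le
  have := mul_nonneg (sq_nonneg h) H.det_pos.le
  unfold modeDet; linarith

theorem modeDet_le (H : StableMode a γ h s) :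
    modeDet a γ h s ≤ 1 - 3 / 4 * (h * (a * s + γ)) := by
  have := mul_le_mul_of_nonneg_left H.h_det_le H.h_pos.le
  unfold modeDet; nlinarith

theorem modeDet_lt_one (H : StableMode a γ h s) : modeDet a γ h s < 1 := by
  have := H.modeDet_le
  have := mul_pos H.h_pos H.trace_pos
  linarith

theorem ahs_le (H : StableMode a γ h s) : a * h * s ≤ 1 / 2 := by
  have := H.h_trace_le
  have := mul_pos H.h_pos H.γ_pos
  linarith

/-- The denominators of the stationary covariance do not vanish. -/
theorem stationary_denoms_pos (H : StableMode a γ h s) :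
    0 < a * s + γ - h * (s * (1 + a * γ)) ∧
      3 ≤ 4 - 2 * h * (a * s + γ) + h ^ 2 * (s * (1 + a * γ)) := by
  have h1 := H.h_det_le
  have h2 := H.trace_pos
  have h3 := H.h_trace_le
  have h4 := mul_nonneg (sq_nonneg h) H.det_pos.le
  constructor <;> linarith

theorem covStep_stationaryCov (H : StableMode a γ h s) :
    covStep a γ h s (stationaryCov a γ h s) = stationaryCov a γ h s := by
  obtain ⟨hT, hW⟩ := H.stationary_denoms_pos
  have hD : (a * s + γ - h * (s * (1 + a * γ))) *
      (4 - 2 * h * (a * s + γ) + h ^ 2 * (s * (1 + a * γ))) ≠ 0 :=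
    (mul_pos hT (by linarith)).ne'
  rw [stationaryCov, biasedVariance_eq H.s_pos.ne']
  have hv : s * (1 / s) = 1 := mul_one_div_cancel H.s_pos.ne'
  have hR := mul_inv_cancel₀ hD
  simp only [div_eq_mul_inv _ ((a * s + γ - h * (s * (1 + a * γ))) * _)]
  generalize (1 / s : ℝ) = v at *
  generalize ((a * s + γ - h * (s * (1 + a * γ))) *
      (4 - 2 * h * (a * s + γ) + h ^ 2 * (s * (1 + a * γ))))⁻¹ = R at *
  -- The two relations `s v = 1` and `D R = 1` make each equation polynomial; the coefficient of
  -- the latter is the residual of the covariance `diag (1 / s, 1)` of the continuous dynamics.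
  simp only [covStep, Prod.mk.injEq]
  refine ⟨?_, ?_, ?_⟩
  · linear_combination (-2 * a * h + a ^ 2 * h ^ 2 * s) * hv - h ^ 2 * (a ^ 2 * s + 1) * hR
  · linear_combination (-(1 - a * h * s) * h) * hv - h ^ 2 * (a * s - γ) * hR
  · linear_combination (h ^ 2 * s) * hv - h ^ 2 * (s + γ ^ 2) * hR

/-- The Cayley–Hamilton relation for the transposed update matrix. -/
theorem modeDual_modeDual (z : ℝ × ℝ) :
    modeDual a γ h s (modeDual a γ h s z) =
      (2 - h * (a * s + γ)) • modeDual a γ h s z - modeDet a γ h s • z := by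
  apply Prod.ext <;> simp [modeDual, modeDet] <;> ring

theorem trace_sq_le (H : StableMode a γ h s) :
    (2 - h * (a * s + γ)) ^ 2 ≤ 4 * modeDet a γ h s := by
  have := mul_le_mul_of_nonneg_left H.discr_nonpos (sq_nonneg h)
  unfold modeDet; nlinarith

theorem abs_iterate_fst_le (H : StableMode a γ h s) (z : ℝ × ℝ) (k : ℕ) :
    |((modeDual a γ h s)^[k] z).1| ≤ Real.sqrt (modeDet a γ h s) ^ k *
      (|z.1| + 2 * k * (|(modeDual a γ h s z).1| + Real.sqrt (modeDet a γ h s) * |z.1|)) := by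
  refine abs_le_of_linear_recurrence (x := fun k => ((modeDual a γ h s)^[k] z).1)
    H.one_fourth_le_modeDet H.trace_sq_le (fun k => ?_) k
  simp only [Function.iterate_succ_apply', modeDual_modeDual]
  simp

theorem abs_iterate_snd_le (H : StableMode a γ h s) (z : ℝ × ℝ) (k : ℕ) :
    |((modeDual a γ h s)^[k] z).2| ≤ Real.sqrt (modeDet a γ h s) ^ k *
      (|z.2| + 2 * k * (|(modeDual a γ h s z).2| + Real.sqrt (modeDet a γ h s) * |z.2|)) := by
  refine abs_le_of_linear_recurrence (x := fun k => ((modeDual a γ h s)^[k] z).2)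
    H.one_fourth_le_modeDet H.trace_sq_le (fun k => ?_) k
  simp only [Function.iterate_succ_apply', modeDual_modeDual]
  simp

theorem tendsto_iterate_modeDual (H : StableMode a γ h s) (z : ℝ × ℝ) :
    Tendsto (fun k => (modeDual a γ h s)^[k] z) atTop (𝓝 0) := by
  have hr0 := Real.sqrt_nonneg (modeDet a γ h s)
  have hr1 : Real.sqrt (modeDet a γ h s) < 1 := by
    rw [Real.sqrt_lt' one_pos]; simpa using H.modeDet_lt_one
  have key : ∀ A B : ℝ, Tendsto (fun k : ℕ => Real.sqrt (modeDet a γ h s) ^ k * (A + 2 * k * B))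
      atTop (𝓝 0) := by
    intro A B
    have h1 := (tendsto_pow_atTop_nhds_zero_of_lt_one hr0 hr1).mul_const A
    have h2 := (tendsto_self_mul_const_pow_of_lt_one hr0 hr1).mul_const (2 * B)
    have h3 := h1.add h2
    simp only [zero_mul, add_zero] at h3
    refine h3.congr fun k => ?_
    ring
  rw [show (0 : ℝ × ℝ) = (0, 0) from rfl]
  refine Tendsto.prodMk_nhds (mx := fun k => ((modeDual a γ h s)^[k] z).1)
    (my := fun k => ((modeDual a γ h s)^[k] z).2) ?_ ?_
  · exact squeeze_zero_norm (fun k => H.abs_iterate_fst_le z k) (key _ _)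
  · exact squeeze_zero_norm (fun k => H.abs_iterate_snd_le z k) (key _ _)

theorem noiseForm_nonneg (H : StableMode a γ h s) (z : ℝ × ℝ) : 0 ≤ noiseForm a γ h z := by
  have := H.a_pos; have := H.γ_pos; have := H.h_pos
  unfold noiseForm; positivity

theorem covForm_stationaryCov_step (H : StableMode a γ h s) (z : ℝ × ℝ) :
    covForm (stationaryCov a γ h s) z =
      covForm (stationaryCov a γ h s) (modeDual a γ h s z) + noiseForm a γ h z := by
  rw [← covForm_covStep, H.covStep_stationaryCov]

/-- The stationary form decreases along the dual dynamics, by the noise form, and its value along a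
trajectory tends to its value at the origin. -/
theorem covForm_stationaryCov_nonneg (H : StableMode a γ h s) (z : ℝ × ℝ) :
    0 ≤ covForm (stationaryCov a γ h s) z := by
  have hmono : ∀ k, covForm (stationaryCov a γ h s) ((modeDual a γ h s)^[k] z) ≤
      covForm (stationaryCov a γ h s) z := by
    intro k
    induction k with
    | zero => simp
    | succ k ih =>
      rw [Function.iterate_succ_apply']
      have := H.covForm_stationaryCov_step ((modeDual a γ h s)^[k] z)
      have := H.noiseForm_nonneg ((modeDual a γ h s)^[k] z)
      linarith
  have hcont : Continuous (covForm (stationaryCov a γ h s)) := by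
    unfold covForm; fun_prop
  have hlim := (hcont.tendsto 0).comp (H.tendsto_iterate_modeDual z)
  have h0 : covForm (stationaryCov a γ h s) 0 = 0 := by simp [covForm]
  rw [h0] at hlim
  exact le_of_tendsto' hlim hmono

/-- The noise of the last step alone contributes `2ah` to the stationary variance. -/
theorem le_biasedVariance (H : StableMode a γ h s) : 2 * a * h ≤ biasedVariance a γ h s := by
  have h1 := H.covForm_stationaryCov_step (1, 0)
  have h2 := H.covForm_stationaryCov_nonneg (modeDual a γ h s (1, 0))
  simp only [covForm, noiseForm, stationaryCov] at h1 h2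
  linarith

theorem biasedVariance_pos (H : StableMode a γ h s) : 0 < biasedVariance a γ h s := by
  have := H.a_pos; have := H.h_pos
  exact lt_of_lt_of_le (by positivity) H.le_biasedVariance

/-- The stationary momentum variance is controlled by the stationary position variance. -/
theorem stationaryCov_snd_snd_le (H : StableMode a γ h s) :
    (stationaryCov a γ h s).2.2 ≤ 1 + s * biasedVariance a γ h s := by
  obtain ⟨hT, hW⟩ := H.stationary_denoms_pos
  have hs := H.s_pos
  have ha := H.a_pos
  have hh := H.h_pos
  have hγ := H.γ_pos
  rw [biasedVariance_eq hs.ne', stationaryCov]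
  simp only
  have hdet := H.det_pos
  have hhγ : h * γ ≤ 1 / 2 := by
    have := H.h_trace_le
    have := mul_pos hh (mul_pos ha hs)
    linarith
  have hF : 0 ≤ 2 * a - h * (1 + a * γ) := by
    have := mul_le_mul_of_nonneg_left hhγ ha.le
    have := H.h_le
    linarith
  have h2 : h * (γ - h * (s * (1 + a * γ)) / 2) ≤ 1 / 2 := by
    have := mul_pos hh (mul_pos hh hdet)
    linarith
  set T := a * s + γ - h * (s * (1 + a * γ)) with hTdef
  set W := 4 - 2 * h * (a * s + γ) + h ^ 2 * (s * (1 + a * γ)) with hWdef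
  have hTW : 0 < T * W := mul_pos hT (by linarith)
  rw [mul_add s (1 / s), mul_one_div_cancel hs.ne']
  have h3 : h * (4 * s + 2 * T * (γ - h * (s * (1 + a * γ)) / 2)) ≤
      (1 + s * (h * (4 + T * (2 * a - h * (1 + a * γ))) / (T * W))) * (T * W) := by
    rw [add_mul, ← mul_div_assoc, div_mul_cancel₀ _ hTW.ne']
    have := mul_le_mul_of_nonneg_left h2 hT.le
    have := mul_le_mul_of_nonneg_left hW hT.le
    have := mul_nonneg (mul_nonneg hs.le hh.le) (mul_nonneg hT.le hF)
    nlinarith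
  rw [← div_le_iff₀ hTW] at h3
  linarith

/-- Differences of two trajectories of the covariance recursion evolve by the dual dynamics. -/
theorem covForm_iterate_sub (H : StableMode a γ h s) (v : ℝ × ℝ × ℝ) (k : ℕ) (z : ℝ × ℝ) :
    covForm ((covStep a γ h s)^[k] v) z - covForm (stationaryCov a γ h s) z =
      covForm v ((modeDual a γ h s)^[k] z) -
        covForm (stationaryCov a γ h s) ((modeDual a γ h s)^[k] z) := by
  induction k generalizing z with
  | zero => rfl
  | succ k ih =>
    rw [Function.iterate_succ_apply', Function.iterate_succ_apply, ← ih, covForm_covStep,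
      H.covForm_stationaryCov_step z]
    ring

/-- The variance of the position after `k` steps approaches the stationary one at rate
`modeDet ^ k`, up to a quadratic factor in `k`. -/
theorem abs_covStep_iterate_sub_le (H : StableMode a γ h s) (k : ℕ) :
    |((covStep a γ h s)^[k] (1, 0, 1)).1 - biasedVariance a γ h s| ≤
      (4 + 2 * biasedVariance a γ h s + 2 * s * biasedVariance a γ h s) *
        (modeDet a γ h s ^ k * (1 + 4 * k) ^ 2) := by
  set y := biasedVariance a γ h s with hy
  have hy0 : 0 < y := H.biasedVariance_pos
  have hk : (0 : ℝ) ≤ k := Nat.cast_nonneg k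
  have hq0 := H.one_fourth_le_modeDet
  have hr0 := Real.sqrt_nonneg (modeDet a γ h s)
  have hr1 : Real.sqrt (modeDet a γ h s) ≤ 1 := by
    rw [Real.sqrt_le_one]; exact H.modeDet_lt_one.le
  have hrk : (Real.sqrt (modeDet a γ h s) ^ k) ^ 2 = modeDet a γ h s ^ k := by
    rw [← pow_mul, mul_comm, pow_mul, Real.sq_sqrt (by linarith)]
  have hahs : |1 - a * h * s| ≤ 1 := by
    have := H.ahs_le
    have := mul_pos (mul_pos H.a_pos H.h_pos) H.s_pos
    rw [abs_le]; constructor <;> linarith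
  have hu := H.abs_iterate_fst_le (1, 0) k
  have hw := H.abs_iterate_snd_le (1, 0) k
  have hdiff := H.covForm_iterate_sub (1, 0, 1) k (1, 0)
  set z := (modeDual a γ h s)^[k] (1, 0) with hz
  set B := modeDet a γ h s ^ k * (1 + 4 * (k : ℝ)) ^ 2 with hB
  have hsq : ∀ t : ℝ, |t| ≤ Real.sqrt (modeDet a γ h s) ^ k * (1 + 4 * k) → t ^ 2 ≤ B := by
    intro t ht
    rw [← sq_abs, hB, ← hrk, ← mul_pow]
    exact pow_le_pow_left₀ (abs_nonneg _) ht 2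
  have hu2 : z.1 ^ 2 ≤ B := by
    refine hsq _ (hu.trans (mul_le_mul_of_nonneg_left ?_ (pow_nonneg hr0 k)))
    simp only [modeDual, abs_one, mul_one, mul_zero, sub_zero]
    nlinarith
  have hw2 : z.2 ^ 2 ≤ B := by
    refine hsq _ (hw.trans (mul_le_mul_of_nonneg_left ?_ (pow_nonneg hr0 k)))
    simp only [modeDual, abs_zero, mul_one, mul_zero, add_zero, zero_add, abs_of_pos H.h_pos]
    have := mul_le_mul_of_nonneg_left H.h_le_one hk
    linarith
  have hc := H.stationaryCov_snd_snd_le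
  rw [← hy] at hc
  have hpos := H.covForm_stationaryCov_nonneg z
  have hneg := H.covForm_stationaryCov_nonneg (z.1, -z.2)
  have hfst : ∀ v : ℝ × ℝ × ℝ, covForm v (1, 0) = v.1 := by intro v; simp [covForm]
  rw [hfst, hfst, show (stationaryCov a γ h s).1 = y from rfl] at hdiff
  rw [hdiff]
  simp only [covForm, show (stationaryCov a γ h s).1 = y from rfl] at hpos hneg ⊢
  have h1 := mul_le_mul_of_nonneg_left hu2 hy0.le
  have h2 := mul_le_mul_of_nonneg_right hc (sq_nonneg z.2)
  have h3 := mul_le_mul_of_nonneg_left hw2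
    (add_nonneg zero_le_one (mul_nonneg H.s_pos.le hy0.le))
  have h4 := sq_nonneg z.1
  have h5 := sq_nonneg z.2
  have h6 : 0 ≤ (y + s * y) * B :=
    mul_nonneg (add_nonneg hy0.le (mul_nonneg H.s_pos.le hy0.le)) (h4.trans hu2)
  rw [abs_le]
  constructor <;> linarith

end StableMode

/-! ### Total variation and domination of measures -/

section TotalVariation

variable {Ω : Type*} [MeasurableSpace Ω]

theorem tvDistance_nonneg (μ ν : Measure Ω) : 0 ≤ tvDistance μ ν :=
  Real.iSup_nonneg fun _ => abs_nonneg _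

theorem abs_measureReal_sub_le_of_smul_le {μ ν : Measure Ω} [IsProbabilityMeasure μ]
    [IsProbabilityMeasure ν] {c : ℝ} (hc : c ≤ 1) (h : ENNReal.ofReal c • μ ≤ ν) {A : Set Ω}
    (hA : MeasurableSet A) : |μ.real A - ν.real A| ≤ 1 - c := by
  have key : ∀ B : Set Ω, μ.real B - ν.real B ≤ 1 - c := by
    intro B
    have h1 : c * μ.real B ≤ ν.real B := by
      have h2 := ENNReal.toReal_mono (measure_ne_top ν B) (h B)
      rw [Measure.smul_apply, smul_eq_mul, ENNReal.toReal_mul] at h2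
      refine le_trans ?_ h2
      rw [ENNReal.toReal_ofReal']
      exact mul_le_mul_of_nonneg_right (le_max_left _ _) measureReal_nonneg
    have h3 : μ.real B ≤ 1 := measureReal_le_one
    nlinarith
  have hc1 := key Aᶜ
  rw [probReal_compl_eq_one_sub hA, probReal_compl_eq_one_sub hA] at hc1
  rw [abs_le]
  constructor
  · linarith
  · exact key A

/-- If two probability measures both dominate large multiples of a third one, they are close in
total variation. -/
theorem tvDistance_le_of_smul_le {μ ν ρ : Measure Ω} [IsProbabilityMeasure μ]
    [IsProbabilityMeasure ν] [IsProbabilityMeasure ρ] {b c : ℝ} (hb : b ≤ 1) (hc : c ≤ 1)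
    (hμ : ENNReal.ofReal b • ρ ≤ μ) (hν : ENNReal.ofReal c • ρ ≤ ν) :
    tvDistance μ ν ≤ (1 - b) + (1 - c) := by
  refine Real.iSup_le (fun A => ?_) (by linarith)
  have h1 := abs_measureReal_sub_le_of_smul_le hb hμ A.2
  have h2 := abs_measureReal_sub_le_of_smul_le hc hν A.2
  rw [abs_sub_comm] at h1
  exact (abs_sub_le _ (ρ.real A.1) _).trans (add_le_add h1 h2)

theorem pi_measure_mono {ι : Type*} [Fintype ι] {α : ι → Type*}
    [∀ i, MeasurableSpace (α i)] {μ ν : ∀ i, Measure (α i)} (h : ∀ i, μ i ≤ ν i) :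
    Measure.pi μ ≤ Measure.pi ν := by
  have hpre : OuterMeasure.pi (fun i => (μ i).toOuterMeasure) ≤
      OuterMeasure.pi (fun i => (ν i).toOuterMeasure) := by
    rw [OuterMeasure.le_pi]
    intro t ht
    refine (OuterMeasure.pi_pi_le _ t).trans ?_
    exact Finset.prod_le_prod' fun i _ => h i (t i)
  refine Measure.le_iff.2 fun A hA => ?_
  rw [Measure.pi, Measure.pi, toMeasure_apply _ _ hA, toMeasure_apply _ _ hA]
  exact hpre A

theorem pi_measure_smul {ι : Type*} [Fintype ι] {α : ι → Type*}
    [∀ i, MeasurableSpace (α i)] (μ : ∀ i, Measure (α i)) [∀ i, SigmaFinite (μ i)]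
    (c : ι → NNReal) :
    Measure.pi (fun i => c i • μ i) = (∏ i, c i) • Measure.pi μ := by
  have : ∀ i, SigmaFinite (c i • μ i) := fun i => inferInstance
  refine Measure.pi_eq fun A _ => ?_
  simp only [Measure.smul_apply, Measure.pi_pi, ENNReal.smul_def, smul_eq_mul,
    Finset.prod_mul_distrib, ENNReal.ofNNReal_finsetProd]

end TotalVariation

/-! ### Total variation between product Gaussians -/

/-- Normalizing constants apart, centered Gaussian densities increase with the variance. -/
theorem sqrt_div_mul_gaussianPDFReal_le {v w : NNReal} (hw : w ≠ 0) (hwv : w ≤ v) (x : ℝ) :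
    Real.sqrt (w / v) * gaussianPDFReal 0 w x ≤ gaussianPDFReal 0 v x := by
  have hw0 : (0 : ℝ) < w := by positivity
  have hwv' : (w : ℝ) ≤ v := by exact_mod_cast hwv
  have hv0 : (0 : ℝ) < v := hw0.trans_le hwv'
  have hπ := Real.pi_pos
  have h1 : Real.sqrt (w / v) * (Real.sqrt (2 * Real.pi * w))⁻¹ =
      (Real.sqrt (2 * Real.pi * v))⁻¹ := by
    rw [← Real.sqrt_inv, ← Real.sqrt_inv, ← Real.sqrt_mul (by positivity)]
    congr 1
    field_simp
  rw [gaussianPDFReal, gaussianPDFReal, ← mul_assoc, h1]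
  refine mul_le_mul_of_nonneg_left (Real.exp_le_exp.2 ?_) (by positivity)
  rw [neg_div, neg_div, neg_le_neg_iff]
  gcongr

/-- The sharp constant is `√(w / v)`; the smaller `w / v` makes later bounds rational. -/
theorem smul_gaussianReal_le {v w : NNReal} (hw : w ≠ 0) (hwv : w ≤ v) :
    Real.toNNReal (w / v) • gaussianReal 0 w ≤ gaussianReal 0 v := by
  have hv : v ≠ 0 := fun h => hw (le_antisymm (h ▸ hwv) zero_le)
  have hv0 : (0 : ℝ) < v := by positivity
  have hwv' : (w : ℝ) ≤ v := by exact_mod_cast hwv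
  rw [gaussianReal_of_var_ne_zero 0 hw, gaussianReal_of_var_ne_zero 0 hv]
  rw [ENNReal.smul_def, ← withDensity_smul _ (measurable_gaussianPDF 0 w)]
  refine withDensity_mono (Eventually.of_forall fun x => ?_)
  have h0 : (0 : ℝ) ≤ w / v := by positivity
  have h1 : (w / v : ℝ) ≤ Real.sqrt (w / v) := by
    apply Real.le_sqrt_of_sq_le
    have : (w / v : ℝ) ≤ 1 := by rw [div_le_one hv0]; exact hwv'
    nlinarith
  simp only [Pi.smul_apply, smul_eq_mul, gaussianPDF]
  rw [← ENNReal.ofReal.eq_1, ← ENNReal.ofReal_mul h0]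
  refine ENNReal.ofReal_le_ofReal (le_trans ?_ (sqrt_div_mul_gaussianPDFReal_le hw hwv x))
  exact mul_le_mul_of_nonneg_right h1 (gaussianPDFReal_nonneg _ _ _)

/-- A Weierstrass product inequality. -/
theorem one_sub_sum_le_prod {ι : Type*} (s : Finset ι) {c : ι → ℝ} (h0 : ∀ i, 0 ≤ c i)
    (h1 : ∀ i, c i ≤ 1) : 1 - ∑ i ∈ s, (1 - c i) ≤ ∏ i ∈ s, c i := by
  classical
  induction s using Finset.induction_on with
  | empty => simp
  | insert i s hi ih =>
    rw [Finset.sum_insert hi, Finset.prod_insert hi]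
    have hp0 : 0 ≤ ∏ i ∈ s, c i := Finset.prod_nonneg fun i _ => h0 i
    have hp1 : ∏ i ∈ s, c i ≤ 1 := Finset.prod_le_one (fun i _ => h0 i) fun i _ => h1 i
    nlinarith [h0 i, h1 i]

theorem ofReal_smul_pi_gaussianReal_le {ι : Type*} [Fintype ι] {v w : ι → NNReal}
    (hw : ∀ i, w i ≠ 0) (hwv : ∀ i, w i ≤ v i) :
    ENNReal.ofReal (1 - ∑ i, (1 - (w i / v i : ℝ))) • Measure.pi (fun i => gaussianReal 0 (w i)) ≤
      Measure.pi (fun i => gaussianReal 0 (v i)) := by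
  refine le_trans ?_ (pi_measure_mono fun i => smul_gaussianReal_le (hw i) (hwv i))
  rw [pi_measure_smul]
  refine Measure.le_iff.2 fun A _ => ?_
  rw [Measure.smul_apply, Measure.smul_apply, ENNReal.smul_def, smul_eq_mul, smul_eq_mul]
  gcongr
  have h0 : ∀ i, (0 : ℝ) ≤ w i / v i := fun i => by positivity
  rw [← Real.toNNReal_prod_of_nonneg fun i _ => h0 i]
  refine ENNReal.ofReal_le_ofReal (one_sub_sum_le_prod _ h0 fun i => ?_)
  exact div_le_one_of_le₀ (by exact_mod_cast hwv i) (NNReal.coe_nonneg _)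

/-- Total variation between (images of) two centered product Gaussians, through comparison with
the product Gaussian whose variances are the coordinatewise minima. -/
theorem tvDistance_map_pi_gaussianReal_le {ι Ω : Type*} [Fintype ι] [MeasurableSpace Ω]
    {f : (ι → ℝ) → Ω} (hf : Measurable f) {v w : ι → NNReal} (hv : ∀ i, v i ≠ 0)
    (hw : ∀ i, w i ≠ 0) :
    tvDistance ((Measure.pi fun i => gaussianReal 0 (v i)).map f)
      ((Measure.pi fun i => gaussianReal 0 (w i)).map f) ≤ ∑ i, |(v i : ℝ) - w i| / w i := by
  have hm : ∀ i, min (v i) (w i) ≠ 0 := fun i => by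
    rcases min_choice (v i) (w i) with h | h <;> rw [h]
    exacts [hv i, hw i]
  have hmap : ∀ u : ι → NNReal,
      IsProbabilityMeasure ((Measure.pi fun i => gaussianReal 0 (u i)).map f) :=
    fun u => Measure.isProbabilityMeasure_map hf.aemeasurable
  have := hmap v
  have := hmap w
  have := hmap fun i => min (v i) (w i)
  have hle : ∀ u : ι → NNReal, (∀ i, min (v i) (w i) ≤ u i) →
      1 - ∑ i, (1 - ((min (v i) (w i) : NNReal) / u i : ℝ)) ≤ 1 := by
    intro u hu
    refine sub_le_self _ (Finset.sum_nonneg fun i _ => sub_nonneg.2 ?_)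
    exact div_le_one_of_le₀ (by exact_mod_cast hu i) (NNReal.coe_nonneg _)
  have hdom : ∀ u : ι → NNReal, (∀ i, min (v i) (w i) ≤ u i) →
      ENNReal.ofReal (1 - ∑ i, (1 - ((min (v i) (w i) : NNReal) / u i : ℝ))) •
        ((Measure.pi fun i => gaussianReal 0 (min (v i) (w i))).map f) ≤
      (Measure.pi fun i => gaussianReal 0 (u i)).map f := by
    intro u hu
    rw [← Measure.map_smul]
    exact Measure.map_mono (ofReal_smul_pi_gaussianReal_le hm hu) hf
  refine (tvDistance_le_of_smul_le (hle v fun i => min_le_left _ _)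
    (hle w fun i => min_le_right _ _) (hdom v fun i => min_le_left _ _)
    (hdom w fun i => min_le_right _ _)).trans ?_
  rw [sub_sub_cancel, sub_sub_cancel, ← Finset.sum_add_distrib]
  refine Finset.sum_le_sum fun i _ => ?_
  have hv0 : (0 : ℝ) < v i := by have := hv i; positivity
  have hw0 : (0 : ℝ) < w i := by have := hw i; positivity
  rcases le_total (v i) (w i) with h | h
  · have h' : (v i : ℝ) ≤ w i := by exact_mod_cast h
    rw [min_eq_left h, div_self hv0.ne', sub_self, zero_add, abs_sub_comm,
      abs_of_nonneg (sub_nonneg.2 h'), sub_div, div_self hw0.ne']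
  · have h' : (w i : ℝ) ≤ v i := by exact_mod_cast h
    rw [min_eq_right h, div_self hw0.ne', sub_self, add_zero, abs_of_nonneg (sub_nonneg.2 h'),
      one_sub_div hv0.ne']
    gcongr

/-! ### The law of the chain in the eigenbasis -/

section Chain

open scoped RealInnerProductSpace

variable {d : ℕ}

/-- The coordinates `Pᵀ u` of a vector in the orthonormal basis formed by the columns of `P`. -/
def eigenCoord (P : Matrix (Fin d) (Fin d) ℝ) (u : EuclideanSpace ℝ (Fin d)) : Fin d → ℝ :=
  P.transpose.mulVec u.ofLp

theorem inner_toLp_mulVec (P : Matrix (Fin d) (Fin d) ℝ) (x : Fin d → ℝ)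
    (u : EuclideanSpace ℝ (Fin d)) :
    ⟪(WithLp.toLp 2 (P.mulVec x) : EuclideanSpace ℝ (Fin d)), u⟫ = ∑ i, x i * eigenCoord P u i := by
  rw [EuclideanSpace.inner_eq_star_dotProduct]
  simp only [star_trivial]
  rw [Matrix.dotProduct_mulVec, ← Matrix.mulVec_transpose, dotProduct_comm]
  rfl

theorem sum_eigenCoord_sq {P : Matrix (Fin d) (Fin d) ℝ}
    (hP : P ∈ Matrix.orthogonalGroup (Fin d) ℝ) (u : EuclideanSpace ℝ (Fin d)) :
    ∑ i, eigenCoord P u i ^ 2 = ‖u‖ ^ 2 := by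
  have hPP : P * P.transpose = 1 := (Matrix.mem_orthogonalGroup_iff (Fin d) ℝ).1 hP
  have h := inner_toLp_mulVec P (eigenCoord P u) u
  rw [eigenCoord, Matrix.mulVec_mulVec, hPP, Matrix.one_mulVec] at h
  rw [← real_inner_self_eq_norm_sq]
  refine Eq.trans ?_ h.symm
  simp only [eigenCoord, pow_two]

theorem eigenCoord_add (P : Matrix (Fin d) (Fin d) ℝ) (u w : EuclideanSpace ℝ (Fin d)) (i : Fin d) :
    eigenCoord P (u + w) i = eigenCoord P u i + eigenCoord P w i := by
  simp [eigenCoord, Matrix.mulVec_add]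

theorem eigenCoord_sub (P : Matrix (Fin d) (Fin d) ℝ) (u w : EuclideanSpace ℝ (Fin d)) (i : Fin d) :
    eigenCoord P (u - w) i = eigenCoord P u i - eigenCoord P w i := by
  simp [eigenCoord, Matrix.mulVec_sub]

theorem eigenCoord_smul (P : Matrix (Fin d) (Fin d) ℝ) (c : ℝ) (u : EuclideanSpace ℝ (Fin d))
    (i : Fin d) : eigenCoord P (c • u) i = c * eigenCoord P u i := by
  simp [eigenCoord, Matrix.mulVec_smul]

theorem eigenCoord_toEuclideanCLM {P M : Matrix (Fin d) (Fin d) ℝ} {s : Fin d → ℝ}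
    (hP : P ∈ Matrix.orthogonalGroup (Fin d) ℝ)
    (hM : M = P * Matrix.diagonal s * P.transpose) (u : EuclideanSpace ℝ (Fin d)) (i : Fin d) :
    eigenCoord P (Matrix.toEuclideanCLM (𝕜 := ℝ) M u) i = s i * eigenCoord P u i := by
  have hPP : P.transpose * P = 1 := (Matrix.mem_orthogonalGroup_iff' (Fin d) ℝ).1 hP
  have h1 : P.transpose * M = Matrix.diagonal s * P.transpose := by
    rw [hM, ← Matrix.mul_assoc, ← Matrix.mul_assoc, hPP, Matrix.one_mul]
  rw [eigenCoord, Matrix.ofLp_toEuclideanCLM, Matrix.mulVec_mulVec, h1, ← Matrix.mulVec_mulVec,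
    Matrix.mulVec_diagonal]
  rfl

theorem inner_toEuclideanCLM_left {M : Matrix (Fin d) (Fin d) ℝ} (hM : M.IsSymm)
    (x u : EuclideanSpace ℝ (Fin d)) :
    ⟪Matrix.toEuclideanCLM (𝕜 := ℝ) M x, u⟫ = ⟪x, Matrix.toEuclideanCLM (𝕜 := ℝ) M u⟫ := by
  rw [EuclideanSpace.inner_eq_star_dotProduct, EuclideanSpace.inner_eq_star_dotProduct,
    Matrix.ofLp_toEuclideanCLM, Matrix.ofLp_toEuclideanCLM]
  simp only [star_trivial]
  rw [Matrix.dotProduct_mulVec, ← Matrix.mulVec_transpose, hM.eq]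

theorem gradient_quadPotential {S : Matrix (Fin d) (Fin d) ℝ} (hS : (S⁻¹).IsSymm)
    (x : EuclideanSpace ℝ (Fin d)) :
    gradient (quadPotential S) x = Matrix.toEuclideanCLM (𝕜 := ℝ) S⁻¹ x := by
  set A := Matrix.toEuclideanCLM (𝕜 := ℝ) S⁻¹ with hA
  have hq : quadPotential S = fun x => (1 / 2) * ⟪x, A x⟫ := by
    funext x
    rw [quadPotential, EuclideanSpace.inner_eq_star_dotProduct, hA, Matrix.ofLp_toEuclideanCLM,
      dotProduct_comm]
    simp
  refine HasGradientAt.gradient ?_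
  rw [hasGradientAt_iff_hasFDerivAt, hq]
  refine (((hasFDerivAt_id x).inner ℝ A.hasFDerivAt).const_mul (1 / 2)).congr_fderiv ?_
  ext y
  have h1 := inner_toEuclideanCLM_left hS y x
  have h2 := inner_toEuclideanCLM_left hS x y
  rw [← hA] at h1 h2
  simp only [one_div, FunLike.coe_smul, ContinuousLinearMap.coe_comp, Pi.smul_apply,
    Function.comp_apply, ContinuousLinearMap.prod_apply, ContinuousLinearMap.coe_id', id_eq,
    fderivInnerCLM_apply, smul_eq_mul, InnerProductSpace.toDual_apply_apply]
  rw [real_inner_comm x (A y), h1, real_inner_comm (A x) y] at *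
  linarith

instance isProbabilityMeasure_stdGaussianPair (d : ℕ) :
    IsProbabilityMeasure (stdGaussianPair d) := by
  unfold stdGaussianPair; infer_instance

theorem measurable_gaulStep {S : Matrix (Fin d) (Fin d) ℝ} (hS : (S⁻¹).IsSymm) (a γ h : ℝ) :
    Measurable (fun q : (EuclideanSpace ℝ (Fin d) × EuclideanSpace ℝ (Fin d)) ×
      (EuclideanSpace ℝ (Fin d) × EuclideanSpace ℝ (Fin d)) =>
      gaulStep (quadPotential S) a γ h q.1 q.2) := by
  simp only [gaulStep, gradient_quadPotential hS]
  fun_prop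

theorem isProbabilityMeasure_gaulOperator {S : Matrix (Fin d) (Fin d) ℝ} (hS : (S⁻¹).IsSymm)
    (a γ h : ℝ) (μ : Measure (EuclideanSpace ℝ (Fin d) × EuclideanSpace ℝ (Fin d)))
    [IsProbabilityMeasure μ] : IsProbabilityMeasure (gaulOperator (quadPotential S) a γ h μ) :=
  Measure.isProbabilityMeasure_map (measurable_gaulStep hS a γ h).aemeasurable

theorem isSymm_conj_diagonal (P : Matrix (Fin d) (Fin d) ℝ) (s : Fin d → ℝ) :
    (P * Matrix.diagonal s * P.transpose).IsSymm := by
  rw [Matrix.IsSymm, Matrix.transpose_mul, Matrix.transpose_mul, Matrix.transpose_transpose,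
    Matrix.diagonal_transpose, Matrix.mul_assoc]

/-- A law on phase space is centered Gaussian, with independent modes `(⟪x, Pᵢ⟫, ⟪p, Pᵢ⟫)` of
covariance `V i`. This is expressed through the characteristic function. -/
def HasModeCov (P : Matrix (Fin d) (Fin d) ℝ) (V : Fin d → ℝ × ℝ × ℝ)
    (μ : Measure (EuclideanSpace ℝ (Fin d) × EuclideanSpace ℝ (Fin d))) : Prop :=
  ∀ u w : EuclideanSpace ℝ (Fin d),
    ∫ z, Complex.exp (((⟪z.1, u⟫ + ⟪z.2, w⟫ : ℝ) : ℂ) * Complex.I) ∂μ =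
      Complex.exp (((-(1 / 2) * ∑ i, covForm (V i) (eigenCoord P u i, eigenCoord P w i) : ℝ)) : ℂ)

theorem integral_exp_stdGaussianPair (u w : EuclideanSpace ℝ (Fin d)) :
    ∫ z, Complex.exp (((⟪z.1, u⟫ + ⟪z.2, w⟫ : ℝ) : ℂ) * Complex.I) ∂(stdGaussianPair d) =
      Complex.exp (((-(1 / 2) * (‖u‖ ^ 2 + ‖w‖ ^ 2) : ℝ)) : ℂ) := by
  unfold stdGaussianPair
  simp only [Complex.ofReal_add, add_mul, Complex.exp_add]
  rw [integral_prod_mul (fun x : EuclideanSpace ℝ (Fin d) => Complex.exp ((⟪x, u⟫ : ℂ) * Complex.I))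
    (fun x : EuclideanSpace ℝ (Fin d) => Complex.exp ((⟪x, w⟫ : ℂ) * Complex.I)),
    ← charFun_apply, ← charFun_apply, charFun_stdGaussian, charFun_stdGaussian, ← Complex.exp_add]
  congr 1
  push_cast
  ring

theorem hasModeCov_stdGaussianPair {P : Matrix (Fin d) (Fin d) ℝ}
    (hP : P ∈ Matrix.orthogonalGroup (Fin d) ℝ) :
    HasModeCov P (fun _ => (1, 0, 1)) (stdGaussianPair d) := by
  intro u w
  rw [integral_exp_stdGaussianPair, ← sum_eigenCoord_sq hP, ← sum_eigenCoord_sq hP,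
    ← Finset.sum_add_distrib]
  simp [covForm]

namespace HasModeCov

variable {P : Matrix (Fin d) (Fin d) ℝ} {V : Fin d → ℝ × ℝ × ℝ}
  {μ ν : Measure (EuclideanSpace ℝ (Fin d) × EuclideanSpace ℝ (Fin d))}

/-- A law on phase space is determined by its mode covariances: every continuous linear form on the
product is of the form `z ↦ ⟪z.1, u⟫ + ⟪z.2, w⟫`. -/
theorem ext [IsProbabilityMeasure μ] [IsProbabilityMeasure ν] (hμ : HasModeCov P V μ)
    (hν : HasModeCov P V ν) : μ = ν := by
  refine Measure.ext_of_charFunDual (funext fun L => ?_)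
  set u := (InnerProductSpace.toDual ℝ _).symm (L.comp (.inl ℝ _ _)) with hu
  set w := (InnerProductSpace.toDual ℝ _).symm (L.comp (.inr ℝ _ _)) with hw
  have hL : ∀ z, L z = ⟪z.1, u⟫ + ⟪z.2, w⟫ := by
    intro z
    rw [real_inner_comm, real_inner_comm w, hu, hw, InnerProductSpace.toDual_symm_apply,
      InnerProductSpace.toDual_symm_apply, ContinuousLinearMap.comp_apply,
      ContinuousLinearMap.comp_apply, ← map_add]
    simp
  rw [charFunDual_apply, charFunDual_apply]
  simp only [hL]
  rw [hμ u w, hν u w]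

/-- One step of the scheme acts on the covariance of each mode by `covStep`. -/
theorem gaulOperator {S : Matrix (Fin d) (Fin d) ℝ} {s : Fin d → ℝ} {a γ h : ℝ}
    [IsProbabilityMeasure μ]
    (hP : P ∈ Matrix.orthogonalGroup (Fin d) ℝ)
    (hS : S⁻¹ = P * Matrix.diagonal s * P.transpose) (ha : 0 ≤ a) (hγ : 0 ≤ γ) (hh : 0 ≤ h)
    (hμ : HasModeCov P V μ) :
    HasModeCov P (fun i => covStep a γ h (s i) (V i))
      (gaulOperator (quadPotential S) a γ h μ) := by
  have hsymm : (S⁻¹).IsSymm := hS ▸ isSymm_conj_diagonal P s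
  intro u w
  set A := Matrix.toEuclideanCLM (𝕜 := ℝ) S⁻¹ with hA
  set u' := u - (a * h) • A u - h • A w with hu'
  set w' := h • u + (1 - γ * h) • w with hw'
  have hmeas := measurable_gaulStep hsymm a γ h
  have hsplit : ∀ q : (EuclideanSpace ℝ (Fin d) × EuclideanSpace ℝ (Fin d)) ×
      (EuclideanSpace ℝ (Fin d) × EuclideanSpace ℝ (Fin d)),
      ⟪(gaulStep (quadPotential S) a γ h q.1 q.2).1, u⟫ +
        ⟪(gaulStep (quadPotential S) a γ h q.1 q.2).2, w⟫ =
      (⟪q.1.1, u'⟫ + ⟪q.1.2, w'⟫) +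
        (⟪q.2.1, Real.sqrt (2 * a * h) • u⟫ + ⟪q.2.2, Real.sqrt (2 * γ * h) • w⟫) := by
    intro q
    simp only [gaulStep, gradient_quadPotential hsymm, hu', hw', inner_add_left, inner_sub_left,
      inner_add_right, inner_sub_right, real_inner_smul_left, real_inner_smul_right,
      inner_toEuclideanCLM_left hsymm]
    ring
  rw [_root_.gaulOperator, integral_map hmeas.aemeasurable
    (Measurable.aestronglyMeasurable (by fun_prop))]
  have hfactor : ∀ q : (EuclideanSpace ℝ (Fin d) × EuclideanSpace ℝ (Fin d)) ×
      (EuclideanSpace ℝ (Fin d) × EuclideanSpace ℝ (Fin d)),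
      Complex.exp (((⟪(gaulStep (quadPotential S) a γ h q.1 q.2).1, u⟫ +
        ⟪(gaulStep (quadPotential S) a γ h q.1 q.2).2, w⟫ : ℝ) : ℂ) * Complex.I) =
      Complex.exp (((⟪q.1.1, u'⟫ + ⟪q.1.2, w'⟫ : ℝ) : ℂ) * Complex.I) *
        Complex.exp (((⟪q.2.1, Real.sqrt (2 * a * h) • u⟫ +
          ⟪q.2.2, Real.sqrt (2 * γ * h) • w⟫ : ℝ) : ℂ) * Complex.I) := by
    intro q
    rw [hsplit, Complex.ofReal_add, add_mul, Complex.exp_add]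
  simp only [hfactor]
  rw [integral_prod_mul (fun z : EuclideanSpace ℝ (Fin d) × EuclideanSpace ℝ (Fin d) =>
      Complex.exp (((⟪z.1, u'⟫ + ⟪z.2, w'⟫ : ℝ) : ℂ) * Complex.I))
    (fun z : EuclideanSpace ℝ (Fin d) × EuclideanSpace ℝ (Fin d) =>
      Complex.exp (((⟪z.1, Real.sqrt (2 * a * h) • u⟫ + ⟪z.2, Real.sqrt (2 * γ * h) • w⟫ : ℝ) : ℂ) *
        Complex.I)), hμ u' w', integral_exp_stdGaussianPair, ← Complex.exp_add,
    ← Complex.ofReal_add, ← sum_eigenCoord_sq hP, ← sum_eigenCoord_sq hP]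
  congr 2
  rw [← Finset.sum_add_distrib, ← mul_add, ← Finset.sum_add_distrib]
  congr 1
  refine Finset.sum_congr rfl fun i _ => ?_
  rw [covForm_covStep]
  simp only [modeDual, noiseForm, hu', hw', eigenCoord_add, eigenCoord_sub, eigenCoord_smul, hA,
    eigenCoord_toEuclideanCLM hP hS, mul_pow]
  rw [Real.sq_sqrt (by positivity), Real.sq_sqrt (by positivity)]
  congr 3
  ring

end HasModeCov

theorem measurable_toLp_mulVec (P : Matrix (Fin d) (Fin d) ℝ) :
    Measurable fun x : Fin d → ℝ =>
      (WithLp.toLp 2 (P.mulVec x) : EuclideanSpace ℝ (Fin d)) := by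
  unfold Matrix.mulVec dotProduct
  fun_prop

theorem charFun_map_pi_gaussianReal (P : Matrix (Fin d) (Fin d) ℝ) (v : Fin d → NNReal)
    (u : EuclideanSpace ℝ (Fin d)) :
    charFun ((Measure.pi fun i => gaussianReal 0 (v i)).map
      (fun x => (WithLp.toLp 2 (P.mulVec x) : EuclideanSpace ℝ (Fin d)))) u =
      Complex.exp ((-(1 / 2) * ∑ i, v i * eigenCoord P u i ^ 2 : ℝ) : ℂ) := by
  have h1 := charFun_pi (μ := fun i => gaussianReal 0 (v i)) (WithLp.toLp 2 (eigenCoord P u))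
  rw [charFun_apply, integral_map (by fun_prop) (Measurable.aestronglyMeasurable (by fun_prop))]
    at h1
  rw [charFun_apply, integral_map (measurable_toLp_mulVec P).aemeasurable
    (Measurable.aestronglyMeasurable (by fun_prop))]
  simp only [inner_toLp_mulVec]
  simp only [PiLp.inner_apply, charFun_gaussianReal, ← Complex.exp_sum] at h1
  refine Eq.trans ?_ (h1.trans ?_)
  · congr 1
    funext x
    congr 4
    funext i
    simp [mul_comm]
  · congr 1
    push_cast
    rw [Finset.mul_sum]
    refine Finset.sum_congr rfl fun i _ => ?_
    ring

/-- The position marginal is an orthogonal image of a product of one-dimensional Gaussians. -/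
theorem HasModeCov.map_fst {P : Matrix (Fin d) (Fin d) ℝ} {V : Fin d → ℝ × ℝ × ℝ}
    {μ : Measure (EuclideanSpace ℝ (Fin d) × EuclideanSpace ℝ (Fin d))}
    [IsProbabilityMeasure μ] (hV : ∀ i, 0 ≤ (V i).1) (hμ : HasModeCov P V μ) :
    μ.map Prod.fst = (Measure.pi fun i => gaussianReal 0 (V i).1.toNNReal).map
      (fun x => (WithLp.toLp 2 (P.mulVec x) : EuclideanSpace ℝ (Fin d))) := by
  have hm := measurable_toLp_mulVec P
  have : IsProbabilityMeasure (μ.map Prod.fst) :=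
    Measure.isProbabilityMeasure_map measurable_fst.aemeasurable
  have := Measure.isProbabilityMeasure_map
    (μ := Measure.pi fun i => gaussianReal 0 (V i).1.toNNReal) hm.aemeasurable
  refine Measure.ext_of_charFun (funext fun u => ?_)
  rw [charFun_map_pi_gaussianReal, charFun_apply, integral_map measurable_fst.aemeasurable
    (Measurable.aestronglyMeasurable (by fun_prop))]
  have h0 := hμ u 0
  simp only [inner_zero_right, add_zero] at h0
  rw [h0]
  congr 3
  refine Finset.sum_congr rfl fun i _ => ?_
  rw [Real.coe_toNNReal _ (hV i)]
  simp [covForm, eigenCoord]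

/-- The multivariate Gaussian with covariance `P diag(y) Pᵀ` is an orthogonal image of a product
of one-dimensional Gaussians. -/
theorem multivariateGaussian_conj_diagonal (P : Matrix (Fin d) (Fin d) ℝ) {y : Fin d → ℝ}
    (hy : ∀ i, 0 ≤ y i) :
    multivariateGaussian 0 (P * Matrix.diagonal y * P.transpose) =
      (Measure.pi fun i => gaussianReal 0 (y i).toNNReal).map
        (fun x => (WithLp.toLp 2 (P.mulVec x) : EuclideanSpace ℝ (Fin d))) := by
  have hm := measurable_toLp_mulVec P
  have := Measure.isProbabilityMeasure_map
    (μ := Measure.pi fun i => gaussianReal 0 (y i).toNNReal) hm.aemeasurable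
  have hpsd : (P * Matrix.diagonal y * P.transpose).PosSemidef := by
    have := (Matrix.PosSemidef.diagonal hy).mul_mul_conjTranspose_same P
    rwa [Matrix.conjTranspose_eq_transpose_of_trivial] at this
  refine Measure.ext_of_charFun (funext fun u => ?_)
  rw [charFun_map_pi_gaussianReal, charFun_multivariateGaussian hpsd, inner_zero_right,
    ← Matrix.mulVec_mulVec, ← Matrix.mulVec_mulVec, Matrix.dotProduct_mulVec,
    ← Matrix.mulVec_transpose]
  have h1 : P.transpose.mulVec u.ofLp ⬝ᵥ (Matrix.diagonal y).mulVec (P.transpose.mulVec u.ofLp) =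
      ∑ i, (y i).toNNReal * eigenCoord P u i ^ 2 := by
    refine Finset.sum_congr rfl fun i _ => ?_
    rw [Matrix.mulVec_diagonal, Real.coe_toNNReal _ (hy i), eigenCoord]
    ring
  rw [h1]
  congr 1
  push_cast
  ring

/-- Every family of nondegenerate mode covariances is realized by a law on phase space, through
the Cholesky factorization of each of them. -/
theorem exists_hasModeCov {P : Matrix (Fin d) (Fin d) ℝ} {V : Fin d → ℝ × ℝ × ℝ}
    (hpos : ∀ i, 0 < (V i).1) (hV : ∀ i z, 0 ≤ covForm (V i) z) :
    ∃ μ : Measure (EuclideanSpace ℝ (Fin d) × EuclideanSpace ℝ (Fin d)),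
      IsProbabilityMeasure μ ∧ HasModeCov P V μ := by
  set α : Fin d → ℝ := fun i => Real.sqrt (V i).1 with hα
  set β : Fin d → ℝ := fun i => (V i).2.1 / Real.sqrt (V i).1 with hβ
  set δ : Fin d → ℝ := fun i => Real.sqrt ((V i).2.2 - (V i).2.1 ^ 2 / (V i).1) with hδ
  have hα2 : ∀ i, α i ^ 2 = (V i).1 := fun i => Real.sq_sqrt (hpos i).le
  have hα0 : ∀ i, α i ≠ 0 := fun i => (Real.sqrt_pos.2 (hpos i)).ne'
  have hαβ : ∀ i, α i * β i = (V i).2.1 := fun i => mul_div_cancel₀ _ (hα0 i)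
  have hβ2 : ∀ i, β i ^ 2 = (V i).2.1 ^ 2 / (V i).1 := fun i => by
    rw [← hα2 i, ← div_pow]
  have hδ2 : ∀ i, δ i ^ 2 = (V i).2.2 - (V i).2.1 ^ 2 / (V i).1 := fun i => by
    refine Real.sq_sqrt ?_
    have h1 := hV i (-(V i).2.1 / (V i).1, 1)
    have h2 := (hpos i).ne'
    refine h1.trans_eq ?_
    simp only [covForm]
    field_simp
    ring
  set g : EuclideanSpace ℝ (Fin d) × EuclideanSpace ℝ (Fin d) →
      EuclideanSpace ℝ (Fin d) × EuclideanSpace ℝ (Fin d) := fun z =>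
    (WithLp.toLp 2 (P.mulVec fun i => α i * z.1 i),
      WithLp.toLp 2 (P.mulVec fun i => β i * z.1 i + δ i * z.2 i)) with hg
  have hgm : Measurable g :=
    ((measurable_toLp_mulVec P).comp (by fun_prop)).prodMk
      ((measurable_toLp_mulVec P).comp (by fun_prop))
  refine ⟨(stdGaussianPair d).map g, Measure.isProbabilityMeasure_map hgm.aemeasurable, ?_⟩
  intro u w
  have hinner : ∀ z, ⟪(g z).1, u⟫ + ⟪(g z).2, w⟫ =
      ⟪z.1, WithLp.toLp 2 fun i => α i * eigenCoord P u i + β i * eigenCoord P w i⟫ +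
        ⟪z.2, WithLp.toLp 2 fun i => δ i * eigenCoord P w i⟫ := by
    intro z
    simp only [hg]
    rw [inner_toLp_mulVec, inner_toLp_mulVec]
    simp only [PiLp.inner_apply, ← Finset.sum_add_distrib]
    refine Finset.sum_congr rfl fun i _ => ?_
    simp
    ring
  rw [integral_map hgm.aemeasurable (Measurable.aestronglyMeasurable (by fun_prop))]
  simp only [hinner]
  rw [integral_exp_stdGaussianPair, EuclideanSpace.real_norm_sq_eq,
    EuclideanSpace.real_norm_sq_eq, ← Finset.sum_add_distrib]
  congr 3
  refine Finset.sum_congr rfl fun i _ => ?_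
  simp only [covForm]
  linear_combination eigenCoord P u i ^ 2 * hα2 i +
    2 * (eigenCoord P u i * eigenCoord P w i) * hαβ i + eigenCoord P w i ^ 2 * (hβ2 i + hδ2 i)

end Chain

/-! ### The parameters of the theorem -/

section Parameters

variable {s₁ sd s a γ h : ℝ}

/-- In terms of `x = √s₁` and `y = √sd`, the parameters are `a = 2 / (x - y)`, `γ = a x y` and
`a h = 1 / (2 x (x + y))`; the discriminant of the mode of curvature `s` is a negative multiple of
`(s₁ - s) (s - sd)`. -/
theorem stableMode_of_parameters (hsd : 0 < sd) (hlt : sd < s₁) (h1 : 1 < s₁)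
    (hs : sd ≤ s) (hs' : s ≤ s₁) (ha : a = 2 / (Real.sqrt s₁ - Real.sqrt sd))
    (hγ : γ = a * sd + 2 * Real.sqrt sd) (hh : h = 1 / (2 * (a * s₁ + γ))) :
    StableMode a γ h s ∧ Real.sqrt sd / (2 * Real.sqrt s₁) ≤ h * (a * s + γ) ∧
      1 / (2 * s₁) ≤ 2 * a * h := by
  set x := Real.sqrt s₁ with hx
  set y := Real.sqrt sd with hy
  have hx2 : x ^ 2 = s₁ := Real.sq_sqrt (by linarith)
  have hy2 : y ^ 2 = sd := Real.sq_sqrt hsd.le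
  have hy0 : 0 < y := Real.sqrt_pos.2 hsd
  have hyx : y < x := Real.sqrt_lt_sqrt hsd.le hlt
  have hx1 : 1 < x := by rw [hx, Real.lt_sqrt zero_le_one]; linarith
  have hx0 : 0 < x := by linarith
  have hxy : 0 < x - y := sub_pos.2 hyx
  have hs0 : 0 < s := hsd.trans_le hs
  have ha0 : 0 < a := by rw [ha]; positivity
  have hax : a * (x - y) = 2 := by rw [ha]; field_simp
  have hγ' : γ = a * (x * y) := by
    rw [hγ, ← hy2]; linear_combination (-y) * hax
  have hγ0 : 0 < γ := by rw [hγ']; positivity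
  have hden : a * s₁ + γ = a * (x * (x + y)) := by rw [hγ', ← hx2]; ring
  have hD : 0 < 2 * (a * (x * (x + y))) := by positivity
  rw [hden] at hh
  have hh0 : 0 < h := by rw [hh]; positivity
  have hhD : h * (2 * (a * (x * (x + y)))) = 1 := by rw [hh]; field_simp
  have hah : a * h = 1 / (2 * (x * (x + y))) := by
    rw [eq_div_iff (by positivity)]; linarith
  have hT : a * s + γ = a * (s + x * y) := by rw [hγ']; ring
  have hhT : h * (a * s + γ) = (s + x * y) / (2 * (x * (x + y))) := by
    rw [hT, ← mul_assoc, mul_comm h a, hah]; ring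
  have hax2 : 2 ≤ a * x := by
    have := mul_pos ha0 hy0; linarith
  have hm : 1 + a * γ = a ^ 2 * (x + y) ^ 2 / 4 := by
    rw [hγ']; linear_combination (-(1 / 4 : ℝ)) * (a * (x - y) + 2) * hax
  refine ⟨⟨ha0, hγ0, hh0, hs0, ?_, ?_, ?_, ?_, ?_⟩, ?_, ?_⟩
  · have h2 : 1 ≤ 2 * (a * (x * (x + y))) := by nlinarith
    rw [hh]
    exact div_le_one_of_le₀ h2 hD.le
  · rw [hh, div_le_iff₀ hD]
    have h3 : 0 ≤ a * a * x * y := by positivity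
    nlinarith
  · rw [hhT, div_le_iff₀ (by positivity)]
    nlinarith
  · rw [hT, hm]
    have h3 : 0 ≤ (x ^ 2 - s) * (s - y ^ 2) :=
      mul_nonneg (by rw [hx2]; linarith) (by rw [hy2]; linarith)
    have h4 := mul_nonneg (sq_nonneg a) h3
    nlinarith
  · rw [hm]
    have h3 : 4 * (h * (s * (a ^ 2 * (x + y) ^ 2 / 4))) * x =
        s * a * (x + y) / 2 * (h * (2 * (a * (x * (x + y))))) := by ring
    rw [hhD, mul_one] at h3
    have h4 : 4 * (h * (s * (a ^ 2 * (x + y) ^ 2 / 4))) * x ≤ (a * s + γ) * x := by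
      rw [h3]
      have h5 : 0 ≤ s * a * (x - y) := by positivity
      have h6 : 0 ≤ γ * x := by positivity
      linarith
    exact le_of_mul_le_mul_right h4 hx0
  · rw [hhT, div_le_div_iff₀ (by positivity) (by positivity)]
    have h3 : 0 ≤ x * (s - y ^ 2) := mul_nonneg hx0.le (by rw [hy2]; linarith)
    linarith
  · rw [mul_assoc, hah, ← hx2, mul_one_div, div_le_div_iff₀ (by positivity) (by positivity)]
    nlinarith

end Parameters

/-! ### Mixing -/

theorem pow_mul_sq_le {q L : ℝ} (hL : 1 ≤ L) (hq0 : 0 ≤ q) (hq : q ≤ 1 - 1 / (4 * L)) (k : ℕ) :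
    q ^ k * (1 + 4 * k) ^ 2 ≤ 4096 * L ^ 2 * Real.exp (-(k / (8 * L))) := by
  have hL0 : 0 < L := by linarith
  have hk : (0 : ℝ) ≤ k := Nat.cast_nonneg k
  have h1 : q ^ k ≤ Real.exp (-(k / (4 * L))) := by
    calc q ^ k ≤ Real.exp (-(1 / (4 * L))) ^ k := by
          refine pow_le_pow_left₀ hq0 (hq.trans ?_) k
          have := Real.add_one_le_exp (-(1 / (4 * L)))
          linarith
      _ = _ := by rw [← Real.exp_nat_mul]; congr 1; ring
  have h2 : 1 + 4 * (k : ℝ) ≤ 64 * L * Real.exp (k / (16 * L)) := by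
    have h3 := mul_le_mul_of_nonneg_left (Real.add_one_le_exp (k / (16 * L)))
      (by positivity : 0 ≤ 64 * L)
    refine le_trans ?_ h3
    have h4 : 64 * L * (k / (16 * L) + 1) = 4 * k + 64 * L := by field_simp; ring
    linarith
  calc q ^ k * (1 + 4 * k) ^ 2
      ≤ Real.exp (-(k / (4 * L))) * (64 * L * Real.exp (k / (16 * L))) ^ 2 := by gcongr
    _ = 4096 * L ^ 2 * (Real.exp (-(k / (4 * L))) * Real.exp (k / (16 * L)) ^ 2) := by ring
    _ = _ := by
      rw [← Real.exp_nat_mul, ← Real.exp_add]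
      congr 2
      field_simp
      ring

theorem covForm_iterate_nonneg {a γ h s : ℝ} (H : StableMode a γ h s) {v : ℝ × ℝ × ℝ}
    (hv : ∀ z, 0 ≤ covForm v z) (k : ℕ) (z : ℝ × ℝ) :
    0 ≤ covForm ((covStep a γ h s)^[k] v) z := by
  induction k generalizing z with
  | zero => exact hv z
  | succ k ih =>
    rw [Function.iterate_succ_apply', covForm_covStep]
    exact add_nonneg (ih _) (H.noiseForm_nonneg z)

theorem covStep_iterate_fst_pos {a γ h s : ℝ} (H : StableMode a γ h s) (k : ℕ) :
    0 < ((covStep a γ h s)^[k] (1, 0, 1)).1 := by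
  cases k with
  | zero => exact one_pos
  | succ k =>
    have h1 := covForm_covStep a γ h s ((covStep a γ h s)^[k] (1, 0, 1)) (1, 0)
    have h2 := covForm_iterate_nonneg H (v := (1, 0, 1))
      (fun z => by simp only [covForm]; nlinarith [sq_nonneg z.1, sq_nonneg z.2]) k
      (modeDual a γ h s (1, 0))
    have h3 := mul_pos H.a_pos H.h_pos
    rw [Function.iterate_succ_apply']
    simp only [noiseForm] at h1
    generalize covStep a γ h s ((covStep a γ h s)^[k] (1, 0, 1)) = v at *
    have h4 : covForm v (1, 0) = v.1 := by simp [covForm]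
    linarith

section Mixing

variable {d : ℕ} {S P : Matrix (Fin d) (Fin d) ℝ} {s : Fin d → ℝ} {a γ h : ℝ}

theorem hasModeCov_iterate (hP : P ∈ Matrix.orthogonalGroup (Fin d) ℝ)
    (hS : S⁻¹ = P * Matrix.diagonal s * P.transpose) (ha : 0 ≤ a) (hγ : 0 ≤ γ) (hh : 0 ≤ h)
    (k : ℕ) :
    IsProbabilityMeasure ((gaulOperator (quadPotential S) a γ h)^[k] (stdGaussianPair d)) ∧
      HasModeCov P (fun i => (covStep a γ h (s i))^[k] (1, 0, 1))
        ((gaulOperator (quadPotential S) a γ h)^[k] (stdGaussianPair d)) := by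
  induction k with
  | zero => exact ⟨isProbabilityMeasure_stdGaussianPair d, hasModeCov_stdGaussianPair hP⟩
  | succ k ih =>
    obtain ⟨h1, h2⟩ := ih
    simp only [Function.iterate_succ_apply']
    exact ⟨isProbabilityMeasure_gaulOperator (hS ▸ isSymm_conj_diagonal P s) a γ h _,
      h2.gaulOperator hP hS ha hγ hh⟩

theorem exists_stationary_law (hP : P ∈ Matrix.orthogonalGroup (Fin d) ℝ)
    (hS : S⁻¹ = P * Matrix.diagonal s * P.transpose) (ha : 0 ≤ a) (hγ : 0 ≤ γ) (hh : 0 ≤ h)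
    (H : ∀ i, StableMode a γ h (s i)) :
    ∃ ρ : Measure (EuclideanSpace ℝ (Fin d) × EuclideanSpace ℝ (Fin d)),
      IsProbabilityMeasure ρ ∧ gaulOperator (quadPotential S) a γ h ρ = ρ ∧
        ρ.map Prod.fst = biasedTarget P s a γ h := by
  obtain ⟨ρ, hρ, hcov⟩ := exists_hasModeCov (P := P)
    (V := fun i => stationaryCov a γ h (s i)) (fun i => (H i).biasedVariance_pos)
    fun i => (H i).covForm_stationaryCov_nonneg
  refine ⟨ρ, hρ, ?_, ?_⟩
  · have := isProbabilityMeasure_gaulOperator (hS ▸ isSymm_conj_diagonal P s) a γ h ρ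
    have h1 := hcov.gaulOperator hP hS ha hγ hh
    simp only [(H _).covStep_stationaryCov] at h1
    exact h1.ext hcov
  · rw [hcov.map_fst fun i => (H i).biasedVariance_pos.le, biasedTarget,
      multivariateGaussian_conj_diagonal P fun i => (H i).biasedVariance_pos.le]
    rfl

/-- Total variation after `k` steps: the relative errors of the mode variances add up. -/
theorem tvDistance_gaulPositionLaw_le (hP : P ∈ Matrix.orthogonalGroup (Fin d) ℝ)
    (hS : S⁻¹ = P * Matrix.diagonal s * P.transpose) (ha : 0 ≤ a) (hγ : 0 ≤ γ) (hh : 0 ≤ h)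
    (H : ∀ i, StableMode a γ h (s i)) (k : ℕ) :
    tvDistance (gaulPositionLaw (quadPotential S) a γ h k) (biasedTarget P s a γ h) ≤
      ∑ i, (4 / biasedVariance a γ h (s i) + 2 + 2 * s i) *
        (modeDet a γ h (s i) ^ k * (1 + 4 * k) ^ 2) := by
  obtain ⟨h1, h2⟩ := hasModeCov_iterate hP hS ha hγ hh k
  rw [gaulPositionLaw, h2.map_fst fun i => (covStep_iterate_fst_pos (H i) k).le, biasedTarget,
      multivariateGaussian_conj_diagonal P fun i => (H i).biasedVariance_pos.le]
  refine (tvDistance_map_pi_gaussianReal_le (measurable_toLp_mulVec P)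
    (fun i => (Real.toNNReal_pos.2 (covStep_iterate_fst_pos (H i) k)).ne')
    fun i => (Real.toNNReal_pos.2 (H i).biasedVariance_pos).ne').trans ?_
  refine Finset.sum_le_sum fun i _ => ?_
  have hy := (H i).biasedVariance_pos
  rw [Real.coe_toNNReal _ (covStep_iterate_fst_pos (H i) k).le, Real.coe_toNNReal _ hy.le,
    div_le_iff₀ hy]
  refine ((H i).abs_covStep_iterate_sub_le k).trans_eq ?_
  field_simp

end Mixing

theorem discreteMixingTime_le {Ω : Type*} [MeasurableSpace Ω] {law : ℕ → Measure Ω}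
    {ν : Measure Ω} {δ : ℝ} {k : ℕ} (hk : tvDistance (law k) ν ≤ δ) :
    discreteMixingTime law ν δ ≤ k :=
  Nat.sInf_le hk

theorem pos_of_posDef_inv {d : ℕ} {S P : Matrix (Fin d) (Fin d) ℝ} {s : Fin d → ℝ}
    (hSp : S.PosDef) (hP : P ∈ Matrix.orthogonalGroup (Fin d) ℝ)
    (hS : S⁻¹ = P * Matrix.diagonal s * P.transpose) (i : Fin d) : 0 < s i := by
  have hU : IsUnit P := IsUnit.of_mul_eq_one _ ((Matrix.mem_orthogonalGroup_iff (Fin d) ℝ).1 hP)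
  have h1 := hSp.inv
  rw [hS] at h1
  have h2 : (P * Matrix.diagonal s * star P).PosDef := by
    rwa [Matrix.star_eq_conjTranspose, Matrix.conjTranspose_eq_transpose_of_trivial]
  exact Matrix.posDef_diagonal_iff.1 (Matrix.IsUnit.posDef_star_right_conjugate_iff hU |>.1 h2) i

end

theorem mainTheorem2 :
    ∃ C : ℝ, 0 < C ∧
      ∀ (d : ℕ) (hd : 0 < d) (S P : Matrix (Fin d) (Fin d) ℝ) (s : Fin d → ℝ)
        (s₁ sd κ a γ h : ℝ),
        S.PosDef →
        P ∈ Matrix.orthogonalGroup (Fin d) ℝ →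
        S⁻¹ = P * Matrix.diagonal s * P.transpose →
        Antitone s →
        s₁ = s ⟨0, hd⟩ →
        sd = s ⟨d - 1, Nat.sub_lt hd Nat.one_pos⟩ →
        1 < s₁ →
        sd < 1 →
        κ = s₁ / sd →
        a = 2 / (Real.sqrt s₁ - Real.sqrt sd) →
        γ = a * sd + 2 * Real.sqrt sd →
        h = 1 / (2 * (a * s₁ + γ)) →
        -- the biased target is the position marginal of a stationary law of the scheme,
        (∃ ρ : Measure (EuclideanSpace ℝ (Fin d) × EuclideanSpace ℝ (Fin d)),
          IsProbabilityMeasure ρ ∧ gaulOperator (quadPotential S) a γ h ρ = ρ ∧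
            ρ.map Prod.fst = biasedTarget P s a γ h) ∧
        -- the law of the position converges to it,
        Tendsto
          (fun k => tvDistance (gaulPositionLaw (quadPotential S) a γ h k)
            (biasedTarget P s a γ h)) atTop (𝓝 0) ∧
        -- and the mixing time obeys the bound
        ∀ δ : ℝ, 0 < δ → δ < 1 →
          (discreteMixingTime (gaulPositionLaw (quadPotential S) a γ h)
            (biasedTarget P s a γ h) δ : ℝ) ≤
            C * (Real.sqrt κ * (Real.log κ + Real.log (1 / δ) + Real.log d)) := by
  refine ⟨138, by norm_num, ?_⟩
  intro d hd S P s s₁ sd κ a γ h hSp hP hS hanti hs1 hsd h1 hsd1 hκ ha hγ hh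
  have hspos := pos_of_posDef_inv hSp hP hS
  have hsd0 : 0 < sd := hsd ▸ hspos _
  have hlt : sd < s₁ := hsd1.trans h1
  have hle : ∀ i, s i ≤ s₁ := fun i => hs1 ▸ hanti (Fin.mk_le_of_le_val (Nat.zero_le _))
  have hge : ∀ i, sd ≤ s i := fun i => hsd ▸ hanti (Fin.le_def.2 (Nat.le_sub_one_of_lt i.2))
  -- The extreme eigenvalues differ, so there are at least two of them; hence `log d` is bounded
  -- below and absorbs all additive constants.
  have hd2 : 2 ≤ d := by
    by_contra hcon
    have hd1 : d = 1 := by omega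
    subst hd1
    exact hlt.ne (hsd.trans hs1.symm)
  have hparam := fun i => stableMode_of_parameters hsd0 hlt h1 (hge i) (hle i) ha hγ hh
  have H : ∀ i, StableMode a γ h (s i) := fun i => (hparam i).1
  have ha0 := (H ⟨0, hd⟩).a_pos.le
  have hγ0 := (H ⟨0, hd⟩).γ_pos.le
  have hh0 := (H ⟨0, hd⟩).h_pos.le
  have hs10 : 0 < s₁ := by linarith
  have hκ1 : 1 ≤ κ := by rw [hκ, le_div_iff₀ hsd0]; linarith
  -- The normalization `sd < 1 < s₁` makes all constants polynomial in `κ`.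
  have hs1κ : s₁ ≤ κ := by
    rw [hκ, le_div_iff₀ hsd0]; nlinarith
  set L := Real.sqrt κ with hL
  have hL2 : L ^ 2 = κ := Real.sq_sqrt (by linarith)
  have hL1 : 1 ≤ L := by rw [hL, Real.one_le_sqrt]; exact hκ1
  have hL0 : 0 < L := by linarith
  have hdpos : (0 : ℝ) < d := by exact_mod_cast hd
  set K : ℝ := 49152 * d * κ ^ 2 with hK
  have hK0 : 0 < K := by positivity
  have htv : ∀ k : ℕ, tvDistance (gaulPositionLaw (quadPotential S) a γ h k)
      (biasedTarget P s a γ h) ≤ K * Real.exp (-(k / (8 * L))) := by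
    intro k
    refine (tvDistance_gaulPositionLaw_le hP hS ha0 hγ0 hh0 H k).trans ?_
    have hterm : ∀ i, (4 / biasedVariance a γ h (s i) + 2 + 2 * s i) *
        (modeDet a γ h (s i) ^ k * (1 + 4 * k) ^ 2) ≤
        12 * κ * (4096 * L ^ 2 * Real.exp (-(k / (8 * L)))) := by
      intro i
      have hq0 := (H i).one_fourth_le_modeDet
      have hy := (H i).biasedVariance_pos
      have hq : modeDet a γ h (s i) ≤ 1 - 1 / (4 * L) := by
        have h2 := (H i).modeDet_le
        have h3 := (hparam i).2.1
        have h4 : Real.sqrt sd / (2 * Real.sqrt s₁) = 1 / (2 * L) := by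
          rw [hL, hκ, Real.sqrt_div hs10.le]
          have := Real.sqrt_pos.2 hsd0
          have := Real.sqrt_pos.2 hs10
          field_simp
        have h5 : 1 / (4 * L) ≤ 3 / 4 * (1 / (2 * L)) := by
          rw [div_mul_div_comm, div_le_div_iff₀ (by positivity) (by positivity)]
          linarith
        rw [h4] at h3
        linarith
      have hinv : 1 / biasedVariance a γ h (s i) ≤ 2 * κ := by
        have h2 : 1 / (2 * κ) ≤ biasedVariance a γ h (s i) :=
          (one_div_le_one_div_of_le (by positivity) (by linarith)).trans
            ((hparam i).2.2.trans (H i).le_biasedVariance)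
        rw [div_le_iff₀ (by positivity)] at h2
        rw [div_le_iff₀ hy]
        linarith
      have hcoef : 4 / biasedVariance a γ h (s i) + 2 + 2 * s i ≤ 12 * κ := by
        have h2 := hle i
        have h3 : 4 / biasedVariance a γ h (s i) = 4 * (1 / biasedVariance a γ h (s i)) := by ring
        linarith
      have hq0' : 0 ≤ modeDet a γ h (s i) := by linarith
      exact mul_le_mul hcoef (pow_mul_sq_le hL1 hq0' hq k) (by positivity) (by positivity)
    refine (Finset.sum_le_sum fun i _ => hterm i).trans_eq ?_
    rw [Finset.sum_const, Finset.card_univ, Fintype.card_fin, nsmul_eq_mul, hL2, hK]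
    ring
  refine ⟨exists_stationary_law hP hS ha0 hγ0 hh0 H, ?_, ?_⟩
  · refine squeeze_zero (fun k => tvDistance_nonneg _ _) htv ?_
    have h2 : Tendsto (fun k : ℕ => (k : ℝ) / (8 * L)) atTop atTop :=
      tendsto_natCast_atTop_atTop.atTop_div_const (by positivity)
    have h3 := (Real.tendsto_exp_neg_atTop_nhds_zero.comp h2).const_mul K
    simpa using h3
  · intro δ hδ0 hδ1
    have hlog2 : 1 / 2 < Real.log 2 := by have := Real.log_two_gt_d9; linarith
    have hlogd : Real.log 2 ≤ Real.log d :=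
      Real.log_le_log two_pos (by exact_mod_cast hd2)
    have hlogκ : 0 ≤ Real.log κ := Real.log_nonneg hκ1
    have hlogδ : 0 ≤ Real.log (1 / δ) := Real.log_nonneg (by rw [le_div_iff₀ hδ0]; linarith)
    have hlogc : Real.log 49152 ≤ 16 * Real.log 2 := by
      have h2 : Real.log ((2 : ℝ) ^ 16) = 16 * Real.log 2 := by rw [Real.log_pow]; norm_num
      rw [← h2]
      exact Real.log_le_log (by norm_num) (by norm_num)
    set k := ⌈8 * L * (Real.log K + Real.log (1 / δ))⌉₊ with hk
    have hlogK : Real.log K = Real.log 49152 + Real.log d + 2 * Real.log κ := by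
      rw [hK, Real.log_mul (by positivity) (by positivity), Real.log_mul (by norm_num) hdpos.ne',
        Real.log_pow]
      norm_num
    have hlogc0 : 0 ≤ Real.log 49152 := Real.log_nonneg (by norm_num)
    have hkδ : K * Real.exp (-(k / (8 * L))) ≤ δ := by
      have h2 : Real.log K + Real.log (1 / δ) ≤ k / (8 * L) := by
        rw [le_div_iff₀ (by positivity), mul_comm]
        exact Nat.le_ceil _
      calc K * Real.exp (-(k / (8 * L)))
          ≤ K * Real.exp (-(Real.log K + Real.log (1 / δ))) := by gcongr
        _ = δ := by
          rw [one_div, Real.log_inv, neg_add, neg_neg, Real.exp_add, Real.exp_neg,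
            Real.exp_log hK0, Real.exp_log hδ0]
          field_simp
    have h3 : (discreteMixingTime (gaulPositionLaw (quadPotential S) a γ h)
        (biasedTarget P s a γ h) δ : ℝ) ≤ k := by
      exact_mod_cast discreteMixingTime_le ((htv k).trans hkδ)
    have h4 : (k : ℝ) ≤ 8 * L * (Real.log K + Real.log (1 / δ)) + 1 := by
      refine (Nat.ceil_lt_add_one ?_).le
      rw [hlogK]
      positivity
    refine h3.trans (h4.trans ?_)
    have h5 : Real.log K + Real.log (1 / δ) ≤
        17 * Real.log d + 2 * Real.log κ + Real.log (1 / δ) := by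
      rw [hlogK]; linarith
    have h6 : 1 ≤ L * (2 * Real.log d) := by nlinarith
    have h7 := mul_le_mul_of_nonneg_left h5 (by positivity : 0 ≤ 8 * L)
    have h8 : 0 ≤ L * Real.log κ := by positivity
    have h9 : 0 ≤ L * Real.log (1 / δ) := by positivity
    linarith
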